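/- Let $\alpha\in(2,4)$ and let $(X_{ij})_{i,j\ge 1}$ be i.i.d. real random variables whose common distribution is symmetric ($X_{11}\stackrel{d}{=}-X_{11}$) and has a regularly varying tail of index $\alpha$, that is, $\mathbb{P}(|X_{11}|>x)=L(x)x^{-\alpha}$ for $x>0$, where $L$ is slowly varying at infinity. Let $p=p_n\to\infty$ be positive integers with $p_n/n\to\gamma\in(0,1)$ as $n\to\infty$. For $n$ so large that $p<n$ and for $0\le i\le p-1$ let $B_{(i)}=(X_{ak})_{1\le a\le i,\,1\le k\le n}$, $$P_i=I_n-B_{(i)}^{\top}\big(B_{(i)}B_{(i)}^{\top}\big)^{-1}B_{(i)},\qquad P_0=I_n,\qquad Q_i=(q_{i,kl})_{1\le k,l\le n}=\frac{1}{n-i}P_i,$$ (with $P_i:=I_n$ where $B_{(i)}B_{(i)}^{\top}$ is singular), and let $$Y_{ij}=\frac{X_{ij}}{\sqrt{X_{i1}^2+\cdots+X_{in}^2}},\qquad 1\le i\le p,\ 1\le j\le n$$ (with $Y_{ij}:=0$ if the denominator vanishes). Then for every $\varepsilon>0$ there is a constant $C>0$, which does not depend on $n$ and $i$, such that for all sufficiently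 large $n$ $$n^4\,\mathbb{E}\Big[\Big(\sum_{k\neq l} q_{i,kl}\,Y_{i+1,k}Y_{i+1,l}\Big)^4\Big]\le C\,n^{-\alpha/2+\varepsilon}\qquad\text{for all } i=0,1,\ldots,p-1,$$ where the sum is over ordered pairs $(k,l)\in\{1,\ldots,n\}^2$ with $k\ne l$, and the expectation is finite. -/

import Mathlib

open MeasureTheory ProbabilityTheory Filter Topology
open scoped Matrix

noncomputable section

namespace HeavyCorr

/-- `L` is slowly varying at infinity: it is measurable, eventually positive, and
`L (t x) / L x → 1` as `x → ∞` for every `t > 0`. -/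
def SlowlyVarying (L : ℝ → ℝ) : Prop :=
  Measurable L ∧ (∀ᶠ x in atTop, 0 < L x) ∧
    ∀ t : ℝ, 0 < t → Tendsto (fun x => L (t * x) / L x) atTop (𝓝 1)

/-- `|ξ|` has a regularly varying tail with index `α`:
`ℙ(|ξ| > x) = L(x) x ^ (-α)` for all `x > 0`, with `L` slowly varying at infinity. -/
def RegVaryingTail {Ω : Type*} [MeasurableSpace Ω] (μ : Measure Ω) (ξ : Ω → ℝ) (α : ℝ) : Prop :=
  ∃ L : ℝ → ℝ, SlowlyVarying L ∧
    ∀ x : ℝ, 0 < x → μ.real {ω | x < |ξ ω|} = L x * x ^ (-α)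

variable {Ω : Type*}

/-- The `i × n` matrix `B_(i)` formed by the first `i` rows of the data matrix with `n` columns.
Rows and columns are numbered from `0`. -/
def firstRows (X : ℕ → ℕ → Ω → ℝ) (n i : ℕ) (ω : Ω) : Matrix (Fin i) (Fin n) ℝ :=
  Matrix.of fun a k => X a k ω

/-- The projection matrix `P_i = I - Bᵀ (B Bᵀ)⁻¹ B` with `B = B_(i)`. For `i = 0` it is the
identity matrix. Where `B Bᵀ` is singular, Mathlib's inverse is `0`, so that `P_i = I` there. -/
def proj (X : ℕ → ℕ → Ω → ℝ) (n i : ℕ) (ω : Ω) : Matrix (Fin n) (Fin n) ℝ :=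
  1 - (firstRows X n i ω)ᵀ * (firstRows X n i ω * (firstRows X n i ω)ᵀ)⁻¹ * firstRows X n i ω

/-- The scaled projection `Q_i = P_i / (n - i)`, with entries `q_{i,kl}`. -/
def Q (X : ℕ → ℕ → Ω → ℝ) (n i : ℕ) (ω : Ω) : Matrix (Fin n) (Fin n) ℝ :=
  ((n : ℝ) - (i : ℝ))⁻¹ • proj X n i ω

/-- The self-normalized entries of the row with (zero-based) number `i`:
`X_{ik} / √(X_{i0}² + ⋯ + X_{i,n-1}²)`. -/
def Y (X : ℕ → ℕ → Ω → ℝ) (n i : ℕ) (k : Fin n) (ω : Ω) : ℝ :=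
  X i k ω / √(∑ l : Fin n, X i l ω ^ 2)

/-- The off-diagonal part `∑_{k ≠ l} q_{i,kl} Y_{i+1,k} Y_{i+1,l}` of the quadratic form: the
projection is built from the first `i` rows, and `Y` is the next row, which has zero-based
number `i`. The sum is over ordered pairs `(k, l)` with `k ≠ l`. -/
def offDiag (X : ℕ → ℕ → Ω → ℝ) (n i : ℕ) (ω : Ω) : ℝ :=
  ∑ k : Fin n, ∑ l : Fin n with k ≠ l, Q X n i ω k l * Y X n i k ω * Y X n i l ω

end HeavyCorr

end

namespace HeavyCorr

/-! Conditionally on the first `i` rows, the projection is a fixed matrix `A`. It is symmetric and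
idempotent, so each row satisfies `∑ l, A k l ^ 2 = A k k ≤ 1`. The next row is independent of it,
hence it suffices to bound the fourth moment of the form uniformly over matrices with row norms at
most one.

By symmetry, random signs may be inserted in that row without changing its law. The form becomes a
Rademacher chaos of order two, and Bonami's inequality bounds its fourth moment by `108 W²`, where
`W = ∑_{k≠l} A_kl² y_k² y_l²`. Since `∑ y_k² ≤ 1`, Cauchy-Schwarz gives `W² ≤ ∑_k y_k² (∑_{l≠k}
A_kl² y_l²)²`.

Outside an event of exponentially small probability, `∑ z² > c n`, so `y_k² ≤ z_k² / (c n)`. Terms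
with three distinct indices then have mean `O(n⁻³)`. In terms with `y_l⁴`, a fourth moment of `z_l`
need not exist, and `y_l⁴ ≤ (y_l²)^(β/2)` with `β < α` yields `O(n^(-1-β/2))`. Summing over `k`
costs a factor `n`, because the row norms absorb the other sums. This is
`exists_integral_offDiagForm_pow_four_le`; finally `n⁴` cancels against `(n - i)⁻⁴`, since `n - i`
is of order `n`. -/

/-! ### Moment inequalities for Rademacher sums and chaoses. -/

/-- The real number `1` or `-1` encoded by a Boolean. -/
noncomputable def signOf (b : Bool) : ℝ := if b then 1 else -1

lemma signOf_true : signOf true = 1 := by simp [signOf]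

lemma signOf_false : signOf false = -1 := by simp [signOf]

lemma sum_signs_succ {n : ℕ} (F : (Fin (n + 1) → Bool) → ℝ) :
    ∑ s, F s = ∑ s : Fin n → Bool, (F (Fin.cons true s) + F (Fin.cons false s)) := by
  rw [← (Fin.consEquiv (fun _ : Fin (n + 1) => Bool)).sum_comp F, Fintype.sum_prod_type,
    Fintype.sum_bool, Finset.sum_add_distrib]
  rfl

/-- The mixed term in the fourth moment of `Q ± L`, controlled by Cauchy-Schwarz. -/
lemma sum_sq_mul_sq_le {ι : Type*} [Fintype ι] (f g : ι → ℝ) {N a b : ℝ} (hN : 0 ≤ N)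
    (ha : 0 ≤ a) (hb : 0 ≤ b) (hf : ∑ s, f s ^ 4 ≤ N * (a ^ 2)) (hg : ∑ s, g s ^ 4 ≤ N * b ^ 2) :
    ∑ s, f s ^ 2 * g s ^ 2 ≤ N * (a * b) := by
  refine le_of_sq_le_sq ?_ (by positivity) 
  calc (∑ s, f s ^ 2 * g s ^ 2) ^ 2 ≤ (∑ s, (f s ^ 2) ^ 2) * ∑ s, (g s ^ 2) ^ 2 :=
        Finset.sum_mul_sq_le_sq_mul_sq _ _ _
    _ = (∑ s, f s ^ 4) * ∑ s, g s ^ 4 := by simp only [← pow_mul]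
    _ ≤ (N * a ^ 2) * (N * b ^ 2) := by
        gcongr
    _ = (N * (a * b)) ^ 2 := by ring

/-- Khinchine's inequality for the fourth moment. -/
lemma sum_signs_linear_pow_four_le (n : ℕ) (a : Fin n → ℝ) :
    ∑ s : Fin n → Bool, (∑ k, a k * signOf (s k)) ^ 4 ≤ 2 ^ n * (3 * (∑ k, a k ^ 2) ^ 2) := by
  induction n with
  | zero => simp
  | succ n ih =>
    have hsq : ∀ (n : ℕ) (a : Fin n → ℝ),
        ∑ s : Fin n → Bool, (∑ k, a k * signOf (s k)) ^ 2 = 2 ^ n * ∑ k, a k ^ 2 := by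
      intro n
      induction n with
      | zero => simp
      | succ n ih =>
        intro a
        rw [sum_signs_succ]
        simp only [Fin.sum_univ_succ, Fin.cons_zero, Fin.cons_succ]
        have h := ih fun k => a k.succ
        calc _ = ∑ s : Fin n → Bool, (2 * a 0 ^ 2 +
              2 * (∑ k, a k.succ * signOf (s k)) ^ 2) := by
              refine Finset.sum_congr rfl fun s _ => ?_
              rw [signOf_true, signOf_false]; ring
          _ = _ := by
              rw [Finset.sum_add_distrib, ← Finset.mul_sum, ← Finset.mul_sum, h]
              simp; ring
    rw [sum_signs_succ]
    simp only [Fin.sum_univ_succ, Fin.cons_zero, Fin.cons_succ]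
    have h4 := ih fun k => a k.succ
    have h2 := hsq n fun k => a k.succ
    set q := ∑ k : Fin n, a k.succ ^ 2
    -- Adding the two values of the first sign cancels the odd powers of `a 0`.
    calc _ = ∑ s : Fin n → Bool, (2 * a 0 ^ 4 +
          12 * a 0 ^ 2 * (∑ k, a k.succ * signOf (s k)) ^ 2 +
          2 * (∑ k, a k.succ * signOf (s k)) ^ 4) := by
          refine Finset.sum_congr rfl fun s _ => ?_
          rw [signOf_true, signOf_false]; ring
      _ = 2 ^ n * (2 * a 0 ^ 4) + 12 * a 0 ^ 2 * (2 ^ n * q) +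
          2 * ∑ s : Fin n → Bool, (∑ k, a k.succ * signOf (s k)) ^ 4 := by
          rw [Finset.sum_add_distrib, Finset.sum_add_distrib, ← Finset.mul_sum,
            ← Finset.mul_sum, ← Finset.mul_sum, h2]
          simp
          ring
      _ ≤ 2 ^ n * (2 * a 0 ^ 4) + 12 * a 0 ^ 2 * (2 ^ n * q) + 2 * (2 ^ n * (3 * q ^ 2)) := by
          gcongr
      _ ≤ _ := by
          -- This is the slack `6 - 2 = 4` in the coefficient of `a 0 ^ 4`; the other coefficients
          -- agree exactly.
          have : 0 ≤ (2 : ℝ) ^ n * (4 * a 0 ^ 4) := by positivity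
          rw [pow_succ (2 : ℝ) n]
          linarith

/-- Bonami's inequality for the fourth moment of a homogeneous Rademacher chaos of order two. -/
lemma sum_signs_quadratic_pow_four_le (n : ℕ) (a : Fin n → Fin n → ℝ) :
    ∑ s : Fin n → Bool,
        (∑ k, ∑ l, if k < l then a k l * signOf (s k) * signOf (s l) else 0) ^ 4
      ≤ 2 ^ n * (27 * (∑ k, ∑ l, if k < l then a k l ^ 2 else 0) ^ 2) := by
  induction n with
  | zero => simp
  | succ n ih =>
    rw [sum_signs_succ]
    simp only [Fin.sum_univ_succ, Fin.cons_zero, Fin.cons_succ, Fin.succ_lt_succ_iff,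
      if_false, Fin.succ_pos, if_true, Fin.not_lt_zero, zero_add]
    set f : (Fin n → Bool) → ℝ := fun s =>
      ∑ k : Fin n, ∑ l : Fin n, if k < l then a k.succ l.succ * signOf (s k) * signOf (s l) else 0
      with hf
    set g : (Fin n → Bool) → ℝ := fun s => ∑ l : Fin n, a 0 l.succ * signOf (s l) with hg
    set x := ∑ k : Fin n, ∑ l : Fin n, if k < l then a k.succ l.succ ^ 2 else 0
    set y := ∑ l : Fin n, a 0 l.succ ^ 2
    have hx : 0 ≤ x := Finset.sum_nonneg fun k _ => Finset.sum_nonneg fun l _ => by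
      split_ifs <;> positivity
    have hy : 0 ≤ y := by positivity
    have h1 : ∑ s, f s ^ 4 ≤ 2 ^ n * (27 * x ^ 2) := ih fun k l => a k.succ l.succ
    have h2 : ∑ s, g s ^ 4 ≤ 2 ^ n * (3 * y ^ 2) :=
      sum_signs_linear_pow_four_le n fun l => a 0 l.succ
    -- Writing `27 x² = 3 (3x)²` gives both fourth moments the common factor `3 * 2 ^ n`. The mixed
    -- term becomes `108 x y`, exactly the cross term of `54 (x + y)²`; this is what makes 27 work.
    have h3 : ∑ s, f s ^ 2 * g s ^ 2 ≤ (3 * 2 ^ n) * ((3 * x) * y) :=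
      sum_sq_mul_sq_le f g (by positivity) (by positivity) hy (by linarith) (by linarith)
    calc _ = ∑ s : Fin n → Bool, (2 * f s ^ 4 + 12 * (f s ^ 2 * g s ^ 2) + 2 * g s ^ 4) := by
          refine Finset.sum_congr rfl fun s _ => ?_
          have e (c : ℝ) : ∑ l : Fin n, a 0 l.succ * c * signOf (s l) = c * g s := by
            rw [hg, Finset.mul_sum]
            exact Finset.sum_congr rfl fun _ _ => by ring
          rw [e, e]
          rw [signOf_true, signOf_false]; ring
      _ = 2 * ∑ s, f s ^ 4 + 12 * ∑ s, f s ^ 2 * g s ^ 2 + 2 * ∑ s, g s ^ 4 := by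
          simp only [Finset.sum_add_distrib, ← Finset.mul_sum]
      _ ≤ 2 * (2 ^ n * (27 * x ^ 2)) + 12 * ((3 * 2 ^ n) * ((3 * x) * y)) +
          2 * (2 ^ n * (3 * y ^ 2)) := by gcongr
      _ ≤ _ := by
          have : 0 ≤ (2 : ℝ) ^ n * (48 * y ^ 2) := by positivity
          rw [pow_succ (2 : ℝ) n]
          linarith

/-- The off-diagonal part of the quadratic form of `A` at `y`. -/
noncomputable def offDiagForm {n : ℕ} (A : Matrix (Fin n) (Fin n) ℝ) (y : Fin n → ℝ) : ℝ :=
  ∑ k, ∑ l with k ≠ l, A k l * y k * y l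

lemma sum_sum_ne_eq {n : ℕ} (f : Fin n → Fin n → ℝ) :
    ∑ k, ∑ l with k ≠ l, f k l = ∑ k, ∑ l, if k < l then f k l + f l k else 0 := by
  have h : ∑ k, ∑ l, (if l < k then f k l else 0) = ∑ k, ∑ l, if k < l then f l k else 0 :=
    Finset.sum_comm
  calc ∑ k, ∑ l with k ≠ l, f k l
      = ∑ k, ∑ l, ((if k < l then f k l else 0) + if l < k then f k l else 0) := by
        refine Finset.sum_congr rfl fun k _ => ?_
        rw [Finset.sum_filter]
        refine Finset.sum_congr rfl fun l _ => ?_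
        rcases lt_trichotomy k l with h | h | h
        · simp [h, h.ne, h.not_gt]
        · simp [h]
        · simp [h, h.ne', h.not_gt]
    _ = ∑ k, ∑ l, ((if k < l then f k l else 0) + if k < l then f l k else 0) := by
        simp only [Finset.sum_add_distrib, h]
    _ = _ := by
        refine Finset.sum_congr rfl fun k _ => Finset.sum_congr rfl fun l _ => ?_
        split_ifs <;> simp

/-- Folding `(k, l)` and `(l, k)` into one coefficient and using `(u + v)² ≤ 2u² + 2v²` costs a
factor 2 in the sum of squares, so `108 = 27 * 2²`. No symmetry of `A` is needed. -/
lemma sum_signs_offDiagForm_pow_four_le {n : ℕ} (A : Matrix (Fin n) (Fin n) ℝ) (y : Fin n → ℝ) :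
    ∑ s : Fin n → Bool, offDiagForm A (fun k => signOf (s k) * y k) ^ 4
      ≤ 2 ^ n * (108 * (∑ k, ∑ l with k ≠ l, A k l ^ 2 * y k ^ 2 * y l ^ 2) ^ 2) := by
  set b : Fin n → Fin n → ℝ := fun k l => A k l * y k * y l + A l k * y l * y k with hb
  have h1 (s : Fin n → Bool) : offDiagForm A (fun k => signOf (s k) * y k) =
      ∑ k, ∑ l, if k < l then b k l * signOf (s k) * signOf (s l) else 0 := by
    rw [offDiagForm, sum_sum_ne_eq]
    refine Finset.sum_congr rfl fun k _ => Finset.sum_congr rfl fun l _ => ?_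
    split_ifs
    · simp only [hb]; ring
    · rfl
  simp only [h1]
  refine (sum_signs_quadratic_pow_four_le n b).trans ?_
  have h0 : 0 ≤ ∑ k, ∑ l, if k < l then b k l ^ 2 else 0 :=
    Finset.sum_nonneg fun k _ => Finset.sum_nonneg fun l _ => by split_ifs <;> positivity
  have h2 : ∑ k, ∑ l, (if k < l then b k l ^ 2 else 0) ≤
      2 * ∑ k, ∑ l with k ≠ l, A k l ^ 2 * y k ^ 2 * y l ^ 2 := by
    rw [sum_sum_ne_eq]
    simp only [Finset.mul_sum]
    refine Finset.sum_le_sum fun k _ => Finset.sum_le_sum fun l _ => ?_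
    split_ifs
    · have := sq_nonneg (A k l * y k * y l - A l k * y l * y k)
      simp only [hb]
      linarith
    · simp
  have h3 := pow_le_pow_left₀ h0 h2 2
  refine mul_le_mul_of_nonneg_left ?_ (by positivity)
  linarith

/-! ### Moments and nondegeneracy from the regularly varying tail. -/

/-- A probability measure whose dyadic tails decay geometrically has the corresponding
absolute moments. -/
lemma integrable_rpow_abs_of_tail {ν : Measure ℝ} [IsProbabilityMeasure ν] {b b' x₀ : ℝ}
    (hb : 0 < b) (hbb : b < b') (hx₀ : 0 < x₀)
    (h : ∀ x, x₀ ≤ x → ν.real {z | 2 * x < |z|} ≤ (2 : ℝ) ^ (-b') * ν.real {z | x < |z|}) :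
    Integrable (fun z => |z| ^ b) ν := by
  have hT : ∀ k : ℕ, ν.real {z | 2 ^ k * x₀ < |z|} ≤ ((2 : ℝ) ^ (-b')) ^ k := by
    intro k
    induction k with
    | zero => simp
    | succ k ih =>
      have h1 := h (2 ^ k * x₀) (le_mul_of_one_le_left hx₀.le (one_le_pow₀ one_le_two))
      rw [← mul_assoc, ← pow_succ'] at h1
      rw [pow_succ' ((2 : ℝ) ^ (-b')) k]
      exact h1.trans (by gcongr)
  have hmeas : ∀ k : ℕ, MeasurableSet {z : ℝ | 2 ^ k * x₀ < |z|} := fun k =>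
    measurableSet_lt measurable_const (by fun_prop)
  -- On the dyadic shell `2^k x₀ < |z| ≤ 2^(k+1) x₀` the `k`-th term alone dominates; integrating
  -- leaves a geometric series of ratio `2^(b - b')`.
  have hpt : ∀ z : ℝ, ENNReal.ofReal (|z| ^ b) ≤ ENNReal.ofReal (x₀ ^ b) +
      ∑' k : ℕ, {z : ℝ | 2 ^ k * x₀ < |z|}.indicator
        (fun _ => ENNReal.ofReal ((2 ^ (k + 1) * x₀) ^ b)) z := by
    intro z
    rcases le_or_gt |z| x₀ with hz | hz
    · refine le_add_right (ENNReal.ofReal_le_ofReal ?_)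
      exact Real.rpow_le_rpow (abs_nonneg _) hz hb.le
    · obtain ⟨k, hk1, hk2⟩ : ∃ k : ℕ, 2 ^ k * x₀ < |z| ∧ |z| ≤ 2 ^ (k + 1) * x₀ := by
        have hex : ∃ m : ℕ, |z| ≤ 2 ^ m * x₀ := by
          obtain ⟨m, hm⟩ := pow_unbounded_of_one_lt (|z| / x₀) one_lt_two
          exact ⟨m, ((div_lt_iff₀ hx₀).1 hm).le⟩
        classical
        have h0 : Nat.find hex ≠ 0 := by
          intro h0
          have := Nat.find_spec hex
          rw [h0] at this
          simp only [pow_zero, one_mul] at this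
          exact absurd this (not_le.2 hz)
        obtain ⟨m, hm⟩ := Nat.exists_eq_succ_of_ne_zero h0
        refine ⟨m, not_le.1 (Nat.find_min hex (by omega)), ?_⟩
        have := Nat.find_spec hex
        rwa [hm] at this
      refine le_add_left (le_trans ?_ (ENNReal.le_tsum k))
      rw [Set.indicator_of_mem (by exact hk1)]
      exact ENNReal.ofReal_le_ofReal (Real.rpow_le_rpow (abs_nonneg _) hk2 hb.le)
  refine ⟨(measurable_abs.pow_const b).aestronglyMeasurable, ?_⟩
  rw [hasFiniteIntegral_iff_ofReal (ae_of_all _ fun z => by positivity)]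
  refine (lintegral_mono hpt).trans_lt ?_
  rw [lintegral_add_left measurable_const, lintegral_tsum fun k =>
    (measurable_const.indicator (hmeas k)).aemeasurable]
  refine ENNReal.add_lt_top.2 ⟨by simp, ?_⟩
  have hr : (2 : ℝ) ^ (b - b') < 1 := Real.rpow_lt_one_of_one_lt_of_neg one_lt_two (by linarith)
  have hsum : Summable fun k : ℕ => (2 * x₀) ^ b * ((2 : ℝ) ^ (b - b')) ^ k :=
    (summable_geometric_of_lt_one (by positivity) hr).mul_left _
  refine lt_of_le_of_lt (ENNReal.tsum_le_tsum fun k => ?_) hsum.tsum_ofReal_lt_top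
  rw [lintegral_indicator_const (hmeas k), ← ofReal_measureReal,
    ← ENNReal.ofReal_mul (by positivity)]
  refine ENNReal.ofReal_le_ofReal ?_
  calc (2 ^ (k + 1) * x₀) ^ b * ν.real {z | 2 ^ k * x₀ < |z|}
      ≤ (2 ^ (k + 1) * x₀) ^ b * ((2 : ℝ) ^ (-b')) ^ k := by gcongr; exact hT k
    _ = (2 * x₀) ^ b * ((2 : ℝ) ^ (b - b')) ^ k := by
      rw [pow_succ, mul_assoc, Real.mul_rpow (by positivity) (by positivity), sub_eq_add_neg,
        Real.rpow_add two_pos, mul_pow, ← Real.rpow_natCast_mul two_pos.le,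
        ← Real.rpow_mul_natCast two_pos.le b, mul_comm (k : ℝ) b]
      ring

/-- For `b < b' < α`, slow variation makes `L (2x) / L x` eventually smaller than `2^(α - b')`, so
doubling `x` shrinks the tail by at least `2^(-b')`. -/
lemma RegVaryingTail.integrable_rpow_abs {ν : Measure ℝ} [IsProbabilityMeasure ν] {α b : ℝ}
    (h : RegVaryingTail ν id α) (hb : 0 < b) (hbα : b < α) :
    Integrable (fun z => |z| ^ b) ν := by
  obtain ⟨L, ⟨-, hpos, hlim⟩, htail⟩ := h
  obtain ⟨b', hb1, hb2⟩ := exists_between hbα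
  have h1 : (1 : ℝ) < 2 ^ (α - b') := Real.one_lt_rpow one_lt_two (by linarith)
  obtain ⟨x₁, hx₁⟩ := eventually_atTop.1 (hpos.and ((hlim 2 two_pos).eventually (gt_mem_nhds h1)))
  refine integrable_rpow_abs_of_tail (x₀ := max x₁ 1) hb hb1 (by positivity) fun x hx => ?_
  have hx0 : 0 < x := lt_of_lt_of_le (by positivity) hx
  obtain ⟨hLx, hL2⟩ := hx₁ x ((le_max_left _ _).trans hx)
  have e1 := htail x hx0
  have e2 := htail (2 * x) (by positivity)
  simp only [id] at e1 e2
  rw [e1, e2, Real.mul_rpow two_pos.le hx0.le]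
  have h3 : L (2 * x) ≤ 2 ^ (α - b') * L x := ((div_lt_iff₀ hLx).1 hL2).le
  calc L (2 * x) * (2 ^ (-α) * x ^ (-α))
      ≤ (2 ^ (α - b') * L x) * (2 ^ (-α) * x ^ (-α)) := by gcongr
    _ = (2 ^ (α - b') * 2 ^ (-α)) * (L x * x ^ (-α)) := by ring
    _ = _ := by rw [← Real.rpow_add two_pos]; congr 2; ring

lemma RegVaryingTail.measure_ne_zero {ν : Measure ℝ} {α : ℝ}
    (h : RegVaryingTail ν id α) : ν {z | z ≠ 0} ≠ 0 := by
  obtain ⟨L, ⟨-, hpos, -⟩, htail⟩ := h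
  obtain ⟨x, hx, hx0⟩ := (hpos.and (eventually_gt_atTop 0)).exists
  intro h0
  have e := htail x hx0
  have : ν {z | x < |id z|} = 0 := measure_mono_null (fun z hz => by
    rintro rfl
    simp only [Set.mem_ofPred_eq, id, abs_zero] at hz
    exact absurd hz hx0.not_gt) h0
  rw [Measure.real, this] at e
  have : 0 < L x * x ^ (-α) := by positivity
  rw [← e, ENNReal.toReal_zero] at this
  exact lt_irrefl _ this

/-! ### Pointwise bounds for self-normalized vectors. -/

/-- The self-normalization `z / ‖z‖₂` of a vector, with value `0` at `z = 0`. -/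
noncomputable def selfNorm {n : ℕ} (z : Fin n → ℝ) (k : Fin n) : ℝ := z k / √(∑ l, z l ^ 2)

lemma selfNorm_sq {n : ℕ} (z : Fin n → ℝ) (k : Fin n) :
    selfNorm z k ^ 2 = z k ^ 2 / ∑ l, z l ^ 2 := by
  rw [selfNorm, div_pow, Real.sq_sqrt (by positivity)]

lemma sum_selfNorm_sq_le_one {n : ℕ} (z : Fin n → ℝ) : ∑ k, selfNorm z k ^ 2 ≤ 1 := by
  simp only [selfNorm_sq, ← Finset.sum_div]
  exact div_self_le_one _

lemma selfNorm_sq_le_one {n : ℕ} (z : Fin n → ℝ) (k : Fin n) : selfNorm z k ^ 2 ≤ 1 :=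
  (Finset.single_le_sum (f := fun k => selfNorm z k ^ 2) (fun _ _ => by positivity)
    (Finset.mem_univ k)).trans (sum_selfNorm_sq_le_one z)

lemma selfNorm_signOf_mul {n : ℕ} (s : Fin n → Bool) (z : Fin n → ℝ) :
    selfNorm (fun k => signOf (s k) * z k) = fun k => signOf (s k) * selfNorm z k := by
  have h : ∀ b, signOf b ^ 2 = 1 := fun b => by cases b <;> simp [signOf]
  ext k
  simp only [selfNorm, mul_pow, h, one_mul, mul_div_assoc]

@[fun_prop]
lemma measurable_selfNorm {n : ℕ} (k : Fin n) : Measurable fun z : Fin n → ℝ => selfNorm z k := by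
  unfold selfNorm
  fun_prop

/-- This crude bound serves only integrability. -/
lemma abs_offDiagForm_selfNorm_le {n : ℕ} {A : Matrix (Fin n) (Fin n) ℝ}
    (hA : ∀ k, ∑ l, A k l ^ 2 ≤ 1) (z : Fin n → ℝ) :
    |offDiagForm A (selfNorm z)| ≤ n * n := by
  have hy (k) : |selfNorm z k| ≤ 1 := (sq_le_one_iff_abs_le_one _).1 (selfNorm_sq_le_one z k)
  have hA1 (k l) : |A k l| ≤ 1 := (sq_le_one_iff_abs_le_one _).1 <|
    (Finset.single_le_sum (f := fun l => A k l ^ 2) (fun _ _ => by positivity)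
      (Finset.mem_univ l)).trans (hA k)
  calc |offDiagForm A (selfNorm z)|
      ≤ ∑ k, ∑ l with k ≠ l, |A k l * selfNorm z k * selfNorm z l| :=
        (Finset.abs_sum_le_sum_abs _ _).trans
          (Finset.sum_le_sum fun k _ => Finset.abs_sum_le_sum_abs _ _)
    _ ≤ ∑ k : Fin n, ∑ l : Fin n, |A k l * selfNorm z k * selfNorm z l| :=
        Finset.sum_le_sum fun k _ => Finset.sum_le_sum_of_subset_of_nonneg (Finset.subset_univ _)
          fun _ _ _ => abs_nonneg _
    _ ≤ ∑ k : Fin n, ∑ l : Fin n, (1 : ℝ) := by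
        refine Finset.sum_le_sum fun k _ => Finset.sum_le_sum fun l _ => ?_
        rw [abs_mul, abs_mul]
        exact mul_le_one₀ (mul_le_one₀ (hA1 k l) (abs_nonneg _) (hy k)) (abs_nonneg _) (hy l)
    _ = n * n := by simp

/-- Dominating function for `y_k² y_l² y_b²` when `∑ z² > t`. -/
noncomputable def tripleBound {n : ℕ} (β t : ℝ) (k l b : Fin n) (z : Fin n → ℝ) : ℝ :=
  if l = b then z k ^ 2 / t * (|z l| ^ β / t ^ (β / 2)) else
    z k ^ 2 / t * (z l ^ 2 / t) * (z b ^ 2 / t)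

lemma tripleBound_nonneg {n : ℕ} {β t : ℝ} (ht : 0 < t) (k l b : Fin n) (z : Fin n → ℝ) :
    0 ≤ tripleBound β t k l b z := by
  unfold tripleBound
  split_ifs <;> positivity

/-- When `l = b`, the number `selfNorm z l ^ 2` lies in `[0, 1]`, so lowering its exponent from `2`
to `β / 2` increases it and leaves only a `β`-th moment to control. -/
lemma selfNorm_sq_mul_le_tripleBound {n : ℕ} {β t : ℝ} (hβ0 : 0 < β) (hβ : β ≤ 4) (ht : 0 < t)
    (z : Fin n → ℝ) (hz : t < ∑ l, z l ^ 2) (k l b : Fin n) :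
    selfNorm z k ^ 2 * (selfNorm z l ^ 2 * selfNorm z b ^ 2) ≤ tripleBound β t k l b z := by
  have hw (k) : selfNorm z k ^ 2 ≤ z k ^ 2 / t := by
    rw [selfNorm_sq]
    gcongr
  unfold tripleBound
  split_ifs with h
  · subst h
    refine mul_le_mul (hw k) ?_ (by positivity) (by positivity)
    calc selfNorm z l ^ 2 * selfNorm z l ^ 2 = (selfNorm z l ^ 2) ^ (2 : ℝ) := by
          rw [Real.rpow_two]; ring
      _ ≤ (selfNorm z l ^ 2) ^ (β / 2) :=
          Real.rpow_le_rpow_of_exponent_ge_of_imp (by positivity) (selfNorm_sq_le_one z l)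
            (by linarith) (fun _ h => absurd h (by positivity))
      _ ≤ (z l ^ 2 / t) ^ (β / 2) := Real.rpow_le_rpow (by positivity) (hw l) (by positivity)
      _ = |z l| ^ β / t ^ (β / 2) := by
          rw [Real.div_rpow (by positivity) ht.le, ← sq_abs, ← Real.rpow_natCast,
            ← Real.rpow_mul (abs_nonneg _)]
          congr 2
          push_cast
          ring
  · rw [← mul_assoc]
    refine mul_le_mul (mul_le_mul (hw k) (hw l) ?_ ?_) (hw b) ?_ ?_ <;> positivity

lemma sq_sum_offDiag_le_one {n : ℕ} {A : Matrix (Fin n) (Fin n) ℝ}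
    (hA : ∀ k, ∑ l, A k l ^ 2 ≤ 1) (z : Fin n → ℝ) :
    (∑ k, ∑ l with k ≠ l, A k l ^ 2 * selfNorm z k ^ 2 * selfNorm z l ^ 2) ^ 2 ≤ 1 := by
  refine pow_le_one₀ (by positivity) ?_
  refine (Finset.sum_le_sum fun k _ => ?_).trans (sum_selfNorm_sq_le_one z)
  calc ∑ l with k ≠ l, A k l ^ 2 * selfNorm z k ^ 2 * selfNorm z l ^ 2
      ≤ ∑ l, A k l ^ 2 * selfNorm z k ^ 2 * selfNorm z l ^ 2 :=
        Finset.sum_le_sum_of_subset_of_nonneg (Finset.subset_univ _) fun _ _ _ => by positivity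
    _ ≤ ∑ l, A k l ^ 2 * selfNorm z k ^ 2 := Finset.sum_le_sum fun l _ =>
        mul_le_of_le_one_right (by positivity) (selfNorm_sq_le_one z l)
    _ = (∑ l, A k l ^ 2) * selfNorm z k ^ 2 := by rw [Finset.sum_mul]
    _ ≤ selfNorm z k ^ 2 := mul_le_of_le_one_left (by positivity) (hA k)

lemma sq_sum_offDiag_le {n : ℕ} {β t : ℝ} (hβ0 : 0 < β) (hβ : β ≤ 4) (ht : 0 < t)
    (A : Matrix (Fin n) (Fin n) ℝ) (z : Fin n → ℝ) (hz : t < ∑ l, z l ^ 2) :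
    (∑ k, ∑ l with k ≠ l, A k l ^ 2 * selfNorm z k ^ 2 * selfNorm z l ^ 2) ^ 2 ≤
      ∑ k, ∑ l with k ≠ l, ∑ b with k ≠ b, A k l ^ 2 * A k b ^ 2 * tripleBound β t k l b z := by
  set v : Fin n → ℝ := fun k => ∑ l with k ≠ l, A k l ^ 2 * selfNorm z l ^ 2 with hv
  have h1 (k) : ∑ l with k ≠ l, A k l ^ 2 * selfNorm z k ^ 2 * selfNorm z l ^ 2 =
      selfNorm z k ^ 2 * v k := by
    rw [hv, Finset.mul_sum]
    exact Finset.sum_congr rfl fun _ _ => by ring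
  simp only [h1]
  calc (∑ k, selfNorm z k ^ 2 * v k) ^ 2
      -- Cauchy-Schwarz with weights `selfNorm z k ^ 2` of total mass at most one keeps a single
      -- index `k` instead of two.
      ≤ (∑ k, selfNorm z k ^ 2) * ∑ k, selfNorm z k ^ 2 * v k ^ 2 :=
        Finset.sum_sq_le_sum_mul_sum_of_sq_le_mul _ (fun _ _ => by positivity)
          (fun _ _ => by positivity) fun _ _ => le_of_eq (by ring)
    _ ≤ ∑ k, selfNorm z k ^ 2 * v k ^ 2 :=
        mul_le_of_le_one_left (by positivity) (sum_selfNorm_sq_le_one z)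
    _ = ∑ k, ∑ l with k ≠ l, ∑ b with k ≠ b, A k l ^ 2 * A k b ^ 2 *
          (selfNorm z k ^ 2 * (selfNorm z l ^ 2 * selfNorm z b ^ 2)) := by
        refine Finset.sum_congr rfl fun k _ => ?_
        rw [sq (v k), hv, Finset.sum_mul_sum, Finset.mul_sum]
        refine Finset.sum_congr rfl fun l _ => ?_
        rw [Finset.mul_sum]
        exact Finset.sum_congr rfl fun b _ => by ring
    _ ≤ _ := by
        gcongr with k _ l _ b _
        exact selfNorm_sq_mul_le_tripleBound hβ0 hβ ht z hz k l b

/-! ### Integrals against the product law and a small-ball estimate. -/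

section Pi

variable {ν : Measure ℝ} [IsProbabilityMeasure ν] {n : ℕ}

lemma integrable_finset_prod_pi (T : Finset (Fin n)) (g : Fin n → ℝ → ℝ)
    (hg : ∀ j, Integrable (g j) ν) :
    Integrable (fun z : Fin n → ℝ => ∏ j ∈ T, g j (z j)) (Measure.pi fun _ => ν) := by
  have h : Integrable (fun z : Fin n → ℝ => ∏ j, (if j ∈ T then g j else 1) (z j))
      (Measure.pi fun _ => ν) := by
    refine Integrable.fintype_prod fun j => ?_
    split_ifs
    · exact hg j
    · exact integrable_const 1
  refine h.congr (ae_of_all _ fun z => ?_)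
  dsimp only
  rw [← Finset.prod_subset (Finset.subset_univ T) fun j _ hj => by simp [hj]]
  exact Finset.prod_congr rfl fun j hj => by simp [hj]

lemma integral_finset_prod_pi (T : Finset (Fin n)) (g : Fin n → ℝ → ℝ) :
    ∫ z : Fin n → ℝ, ∏ j ∈ T, g j (z j) ∂(Measure.pi fun _ => ν) = ∏ j ∈ T, ∫ x, g j x ∂ν := by
  have h : ∀ z : Fin n → ℝ, ∏ j ∈ T, g j (z j) = ∏ j, (if j ∈ T then g j else 1) (z j) := by
    intro z
    rw [← Finset.prod_subset (Finset.subset_univ T) fun j _ hj => by simp [hj]]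
    exact Finset.prod_congr rfl fun j hj => by simp [hj]
  simp only [h]
  rw [integral_fintype_prod_eq_prod (μ := fun _ : Fin n => ν)
    (fun j => if j ∈ T then g j else 1),
    ← Finset.prod_subset (Finset.subset_univ T) fun j _ hj => by simp [hj]]
  exact Finset.prod_congr rfl fun j hj => by simp [hj]

/-- Being off the diagonal keeps `k` apart from `l` and `b`, so only `l = b` can merge coordinates;
distinct coordinates factor by independence. -/
lemma integrable_tripleBound_and_integral_eq {β : ℝ} (h2 : Integrable (fun x => x ^ 2) ν)
    (hβ : Integrable (fun x => |x| ^ β) ν) (t : ℝ) {k l b : Fin n} (hkl : k ≠ l) (hkb : k ≠ b) :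
    Integrable (tripleBound β t k l b) (Measure.pi fun _ => ν) ∧
      ∫ z, tripleBound β t k l b z ∂(Measure.pi fun _ => ν) =
        if l = b then (∫ x, x ^ 2 ∂ν) * (∫ x, |x| ^ β ∂ν) / (t * t ^ (β / 2)) else
          (∫ x, x ^ 2 ∂ν) ^ 3 / t ^ 3 := by
  by_cases hlb : l = b
  · subst hlb
    set g : Fin n → ℝ → ℝ := fun j x => if j = l then |x| ^ β else x ^ 2 with hg
    have hgi : ∀ j, Integrable (g j) ν := fun j => by
      by_cases h : j = l <;> simp [hg, h, h2, hβ]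
    have he : tripleBound β t k l l =
        fun z => (∏ j ∈ {k, l}, g j (z j)) * (t * t ^ (β / 2))⁻¹ := by
      ext z
      rw [Finset.prod_pair hkl]
      simp only [tripleBound, hg, hkl, if_true, if_false]
      rw [div_mul_div_comm, div_eq_mul_inv]
    rw [he]
    refine ⟨(integrable_finset_prod_pi _ g hgi).mul_const _, ?_⟩
    rw [integral_mul_const, integral_finset_prod_pi, Finset.prod_pair hkl]
    simp [hg, hkl, div_eq_mul_inv]
  · set g : Fin n → ℝ → ℝ := fun _ x => x ^ 2 with hg
    have hk : k ∉ ({l, b} : Finset (Fin n)) := by simp [hkl, hkb]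
    have he : tripleBound β t k l b =
        fun z => (∏ j ∈ {k, l, b}, g j (z j)) * (t ^ 3)⁻¹ := by
      ext z
      rw [Finset.prod_insert hk, Finset.prod_pair hlb]
      simp only [tripleBound, hg, hlb, if_false]
      rw [div_mul_div_comm, div_mul_div_comm, div_eq_mul_inv]
      ring
    rw [he]
    refine ⟨(integrable_finset_prod_pi _ g fun _ => h2).mul_const _, ?_⟩
    rw [integral_mul_const, integral_finset_prod_pi, Finset.prod_insert hk, Finset.prod_pair hlb]
    simp only [hg, hlb, if_false, div_eq_mul_inv]
    ring

lemma integral_tripleBound_le {β c : ℝ} (hβ4 : β ≤ 4) (hc : 0 < c)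
    (h2 : Integrable (fun x => x ^ 2) ν) (hβ : Integrable (fun x => |x| ^ β) ν)
    {k l b : Fin n} (hkl : k ≠ l) (hkb : k ≠ b) :
    ∫ z, tripleBound β (c * n) k l b z ∂(Measure.pi fun _ => ν) ≤
      ((∫ x, x ^ 2 ∂ν) * (∫ x, |x| ^ β ∂ν) / (c * c ^ (β / 2)) + (∫ x, x ^ 2 ∂ν) ^ 3 / c ^ 3) *
        ((n : ℝ) ^ (-(β / 2)) * (n : ℝ)⁻¹) := by
  have hn : 1 ≤ (n : ℝ) := by exact_mod_cast (show 1 ≤ n from k.pos)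
  have hn0 : 0 < (n : ℝ) := by positivity
  have hm2 : 0 ≤ ∫ x, x ^ 2 ∂ν := integral_nonneg fun x => by positivity
  have hmβ : 0 ≤ ∫ x, |x| ^ β ∂ν := integral_nonneg fun x => by positivity
  rw [(integrable_tripleBound_and_integral_eq h2 hβ _ hkl hkb).2, add_mul]
  split_ifs
  · refine (le_of_eq ?_).trans (le_add_of_nonneg_right (by positivity))
    rw [Real.mul_rpow hc.le hn0.le, Real.rpow_neg hn0.le]
    field_simp
  · refine le_trans ?_ (le_add_of_nonneg_left (by positivity))
    -- As `β ≤ 4`, the order `n⁻³` of three distinct indices is no worse than `n^(-1-β/2)`.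
    have h3 : ((n : ℝ) ^ 2)⁻¹ ≤ (n : ℝ) ^ (-(β / 2)) := by
      rw [← Real.rpow_natCast, ← Real.rpow_neg hn0.le]
      refine Real.rpow_le_rpow_of_exponent_le hn ?_
      push_cast
      linarith
    calc (∫ x, x ^ 2 ∂ν) ^ 3 / (c * n) ^ 3
        = (∫ x, x ^ 2 ∂ν) ^ 3 / c ^ 3 * (((n : ℝ) ^ 2)⁻¹ * (n : ℝ)⁻¹) := by
          field_simp
      _ ≤ _ := by gcongr

/-- Exponential small-ball estimate for the sum of squares of i.i.d. nondegenerate variables. -/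
lemma exists_measure_sum_sq_le_pow (hν : ν {x | x ≠ 0} ≠ 0) :
    ∃ c ρ : ℝ, 0 < c ∧ 0 < ρ ∧ ρ < 1 ∧ ∀ n : ℕ,
      (Measure.pi fun _ : Fin n => ν).real {z | ∑ k, z k ^ 2 ≤ c * n} ≤ ρ ^ n := by
  have hle : ∀ x : ℝ, Real.exp (-x ^ 2) ≤ 1 := fun x =>
    Real.exp_le_one_iff.2 (by nlinarith [sq_nonneg x])
  have hint : Integrable (fun x : ℝ => Real.exp (-x ^ 2)) ν :=
    Integrable.of_bound (by fun_prop) 1 (ae_of_all _ fun x => by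
      rw [Real.norm_eq_abs, abs_of_pos (Real.exp_pos _)]; exact hle x)
  set r := ∫ x, Real.exp (-x ^ 2) ∂ν with hr
  have hr0 : 0 < r := integral_exp_pos hint
  -- Nondegeneracy enters here: `1 - exp (-x²)` vanishes only at `0`.
  have hr1 : r < 1 := by
    have h1 : 0 < ∫ x, (1 - Real.exp (-x ^ 2)) ∂ν := by
      rw [integral_pos_iff_support_of_nonneg (fun x => sub_nonneg.2 (hle x))
        ((integrable_const 1).sub hint), pos_iff_ne_zero]
      have : Function.support (fun x : ℝ => 1 - Real.exp (-x ^ 2)) = {x | x ≠ 0} := by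
        ext x
        simp [sub_eq_zero, eq_comm (a := (1 : ℝ))]
      rwa [this]
    rw [integral_sub (integrable_const 1) hint] at h1
    simpa using h1
  have hlog : Real.log r < 0 := Real.log_neg hr0 hr1
  -- With this `c`, half of the exponential rate survives in the Chernoff bound: `exp c * r = exp
  -- (-c)`.
  set c := -Real.log r / 2 with hc
  have hc0 : 0 < c := by rw [hc]; linarith
  have hcr : Real.exp c * r = Real.exp (-c) := by
    calc Real.exp c * r = Real.exp (c + Real.log r) := by rw [Real.exp_add, Real.exp_log hr0]
      _ = Real.exp (-c) := by rw [hc]; ring_nf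
  refine ⟨c, Real.exp (-c), hc0, Real.exp_pos _, by simpa using hc0, fun n => ?_⟩
  have hprod : ∀ z : Fin n → ℝ,
      ∏ k, (Real.exp c * Real.exp (-z k ^ 2)) = Real.exp (c * n - ∑ k, z k ^ 2) := by
    intro z
    simp only [← Real.exp_add, ← Real.exp_sum]
    congr 1
    simp [Finset.sum_add_distrib]
    ring
  have hI : Integrable (fun z : Fin n → ℝ => ∏ k, (Real.exp c * Real.exp (-z k ^ 2)))
      (Measure.pi fun _ => ν) :=
    Integrable.fintype_prod (f := fun _ x => Real.exp c * Real.exp (-x ^ 2))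
      fun _ => hint.const_mul _
  have hset : MeasurableSet {z : Fin n → ℝ | ∑ k, z k ^ 2 ≤ c * n} :=
    measurableSet_le (by fun_prop) measurable_const
  calc (Measure.pi fun _ : Fin n => ν).real {z | ∑ k, z k ^ 2 ≤ c * n}
      = ∫ z, {z : Fin n → ℝ | ∑ k, z k ^ 2 ≤ c * n}.indicator 1 z ∂(Measure.pi fun _ => ν) :=
        (integral_indicator_one hset).symm
    _ ≤ ∫ z : Fin n → ℝ, ∏ k, (Real.exp c * Real.exp (-z k ^ 2)) ∂(Measure.pi fun _ => ν) := by
        refine integral_mono ((integrable_const 1).indicator hset) hI fun z => ?_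
        refine Set.indicator_apply_le' (fun hz => ?_) fun _ => by positivity
        dsimp only
        rw [hprod]
        exact Real.one_le_exp (sub_nonneg.2 hz)
    _ = Real.exp (-c) ^ n := by
        rw [integral_fintype_prod_eq_prod (μ := fun _ : Fin n => ν)
          (fun _ x => Real.exp c * Real.exp (-x ^ 2))]
        simp [integral_const_mul, ← hr, hcr]

end Pi

/-! ### Symmetrization and the uniform bound for a fixed matrix. -/

lemma measurePreserving_signOf_mul {ν : Measure ℝ} (hsymm : ν.map (fun x => -x) = ν) (b : Bool) :
    MeasurePreserving (fun x => signOf b * x) ν ν := by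
  cases b
  · simp only [signOf_false, neg_one_mul]
    exact ⟨measurable_neg, hsymm⟩
  · simp only [signOf_true, one_mul]
    exact MeasurePreserving.id ν

lemma measurable_offDiagForm_selfNorm {n : ℕ} (A : Matrix (Fin n) (Fin n) ℝ) :
    Measurable fun z : Fin n → ℝ => offDiagForm A (selfNorm z) := by
  unfold offDiagForm
  fun_prop

lemma integrable_offDiagForm_selfNorm_pow {n : ℕ} {ν : Measure ℝ} [IsProbabilityMeasure ν]
    {A : Matrix (Fin n) (Fin n) ℝ} (hA : ∀ k, ∑ l, A k l ^ 2 ≤ 1) :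
    Integrable (fun z => offDiagForm A (selfNorm z) ^ 4) (Measure.pi fun _ => ν) :=
  Integrable.of_bound ((measurable_offDiagForm_selfNorm A).pow_const 4).aestronglyMeasurable
    ((n * n : ℝ) ^ 4) (ae_of_all _ fun z => by
      rw [Real.norm_eq_abs, abs_pow]
      exact pow_le_pow_left₀ (abs_nonneg _) (abs_offDiagForm_selfNorm_le hA z) 4)

/-- Symmetrization: the fourth moment is controlled by the second moment of the sum of squares. -/
lemma integral_offDiagForm_pow_four_le {n : ℕ} {ν : Measure ℝ} [IsProbabilityMeasure ν]
    (hsymm : ν.map (fun x => -x) = ν) {A : Matrix (Fin n) (Fin n) ℝ}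
    (hA : ∀ k, ∑ l, A k l ^ 2 ≤ 1) {D : (Fin n → ℝ) → ℝ}
    (hD : Integrable D (Measure.pi fun _ => ν))
    (hWD : ∀ z, (∑ k, ∑ l with k ≠ l, A k l ^ 2 * selfNorm z k ^ 2 * selfNorm z l ^ 2) ^ 2 ≤ D z) :
    ∫ z, offDiagForm A (selfNorm z) ^ 4 ∂(Measure.pi fun _ => ν) ≤
      108 * ∫ z, D z ∂(Measure.pi fun _ => ν) := by
  have hmp (s : Fin n → Bool) : MeasurePreserving (fun (z : Fin n → ℝ) k => signOf (s k) * z k)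
      (Measure.pi fun _ => ν) (Measure.pi fun _ => ν) :=
    measurePreserving_pi _ _ fun k => measurePreserving_signOf_mul hsymm (s k)
  have hi := integrable_offDiagForm_selfNorm_pow (ν := ν) hA
  have hs (s : Fin n → Bool) :
      Integrable (fun z => offDiagForm A (fun k => signOf (s k) * selfNorm z k) ^ 4)
        (Measure.pi fun _ => ν) := by
    have := (hmp s).integrable_comp_of_integrable hi
    simpa only [Function.comp_def, selfNorm_signOf_mul] using this
  have he (s : Fin n → Bool) :
      ∫ z, offDiagForm A (fun k => signOf (s k) * selfNorm z k) ^ 4 ∂(Measure.pi fun _ => ν) =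
      ∫ z, offDiagForm A (selfNorm z) ^ 4 ∂(Measure.pi fun _ => ν) := by
    conv_rhs => rw [← (hmp s).map_eq]
    rw [integral_map (hmp s).measurable.aemeasurable
      ((measurable_offDiagForm_selfNorm A).pow_const 4).aestronglyMeasurable]
    simp only [selfNorm_signOf_mul]
  -- Every sign pattern gives the same integral, so one integral is the average over all `2 ^ n`
  -- patterns.
  have h1 : (2 : ℝ) ^ n * ∫ z, offDiagForm A (selfNorm z) ^ 4 ∂(Measure.pi fun _ => ν) =
      ∫ z, ∑ s : Fin n → Bool, offDiagForm A (fun k => signOf (s k) * selfNorm z k) ^ 4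
        ∂(Measure.pi fun _ => ν) := by
    rw [integral_finsetSum _ fun s _ => hs s]
    simp [he]
  have h2 : ∫ z, ∑ s : Fin n → Bool, offDiagForm A (fun k => signOf (s k) * selfNorm z k) ^ 4
        ∂(Measure.pi fun _ => ν) ≤ ∫ z, 2 ^ n * (108 * D z) ∂(Measure.pi fun _ => ν) := by
    refine integral_mono (integrable_finsetSum _ fun s _ => hs s)
      ((hD.const_mul _).const_mul _) fun z => ?_
    refine (sum_signs_offDiagForm_pow_four_le A (selfNorm z)).trans ?_
    gcongr
    exact hWD z
  rw [← h1, integral_const_mul, integral_const_mul] at h2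
  exact le_of_mul_le_mul_left h2 (by positivity)

/-- Uniform fourth moment bound for self-normalized off-diagonal quadratic forms. -/
lemma exists_integral_offDiagForm_pow_four_le {ν : Measure ℝ} [IsProbabilityMeasure ν]
    (hsymm : ν.map (fun x => -x) = ν) (hν : ν {x | x ≠ 0} ≠ 0) {β : ℝ} (hβ0 : 0 < β) (hβ4 : β ≤ 4)
    (h2 : Integrable (fun x => x ^ 2) ν) (hβ : Integrable (fun x => |x| ^ β) ν) :
    ∃ C : ℝ, 0 < C ∧ ∀ᶠ n : ℕ in atTop, ∀ A : Matrix (Fin n) (Fin n) ℝ,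
      (∀ k, ∑ l, A k l ^ 2 ≤ 1) →
        ∫ z, offDiagForm A (selfNorm z) ^ 4 ∂(Measure.pi fun _ => ν) ≤
          C * (n : ℝ) ^ (-(β / 2)) := by
  obtain ⟨c, ρ, hc, hρ0, hρ1, hball⟩ := exists_measure_sum_sq_le_pow hν
  set M := (∫ x, x ^ 2 ∂ν) * (∫ x, |x| ^ β ∂ν) / (c * c ^ (β / 2)) + (∫ x, x ^ 2 ∂ν) ^ 3 / c ^ 3
    with hM
  have hm2 : 0 ≤ ∫ x, x ^ 2 ∂ν := integral_nonneg fun x => by positivity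
  have hmβ : 0 ≤ ∫ x, |x| ^ β ∂ν := integral_nonneg fun x => by positivity
  have hM0 : 0 ≤ M := by positivity
  refine ⟨108 * (1 + M), by positivity, ?_⟩
  filter_upwards [eventually_ge_atTop 1, (tendsto_pow_const_mul_const_pow_of_lt_one 2 hρ0.le
    hρ1).eventually (gt_mem_nhds one_pos)] with n hn hρn A hA
  have hn1 : 1 ≤ (n : ℝ) := by exact_mod_cast hn
  have hn0 : 0 < (n : ℝ) := by positivity
  have ht : 0 < c * n := by positivity
  have hρβ : ρ ^ n ≤ (n : ℝ) ^ (-(β / 2)) := by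
    calc ρ ^ n ≤ ((n : ℝ) ^ 2)⁻¹ := by
          rw [le_inv_comm₀ (by positivity) (by positivity), ← one_div, le_div_iff₀ (by positivity)]
          exact hρn.le
      _ ≤ _ := by
          rw [← Real.rpow_natCast, ← Real.rpow_neg hn0.le]
          refine Real.rpow_le_rpow_of_exponent_le hn1 ?_
          push_cast
          linarith
  set bad : Set (Fin n → ℝ) := {z | ∑ k, z k ^ 2 ≤ c * n} with hbad
  have hset : MeasurableSet bad := measurableSet_le (by fun_prop) measurable_const
  set E : (Fin n → ℝ) → ℝ := fun z => ∑ k, ∑ l with k ≠ l, ∑ b with k ≠ b,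
    A k l ^ 2 * A k b ^ 2 * tripleBound β (c * n) k l b z with hE
  have hE0 (z) : 0 ≤ E z := Finset.sum_nonneg fun k _ => Finset.sum_nonneg fun l _ =>
    Finset.sum_nonneg fun b _ => mul_nonneg (by positivity) (tripleBound_nonneg ht k l b z)
  have hEterm : ∀ k : Fin n, ∀ l ∈ Finset.univ.filter (k ≠ ·), ∀ b ∈ Finset.univ.filter (k ≠ ·),
      Integrable (fun z => A k l ^ 2 * A k b ^ 2 * tripleBound β (c * n) k l b z)
        (Measure.pi fun _ => ν) := fun k l hl b hb =>
    (integrable_tripleBound_and_integral_eq h2 hβ _ (Finset.mem_filter.1 hl).2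
      (Finset.mem_filter.1 hb).2).1.const_mul _
  have hEi : Integrable E (Measure.pi fun _ => ν) :=
    integrable_finsetSum _ fun k _ => integrable_finsetSum _ fun l hl =>
      integrable_finsetSum _ fun b hb => hEterm k l hl b hb
  have hbi : Integrable (bad.indicator (1 : (Fin n → ℝ) → ℝ)) (Measure.pi fun _ => ν) :=
    (integrable_const 1).indicator hset
  have hWD (z) : (∑ k, ∑ l with k ≠ l, A k l ^ 2 * selfNorm z k ^ 2 * selfNorm z l ^ 2) ^ 2 ≤
      bad.indicator 1 z + E z := by
    by_cases hz : z ∈ bad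
    · rw [Set.indicator_of_mem hz]
      exact (sq_sum_offDiag_le_one hA z).trans (le_add_of_nonneg_right (hE0 z))
    · rw [Set.indicator_of_notMem hz, zero_add]
      exact sq_sum_offDiag_le hβ0 hβ4 ht A z (not_le.1 hz)
  have hEint : ∫ z, E z ∂(Measure.pi fun _ => ν) ≤ M * (n : ℝ) ^ (-(β / 2)) := by
    have hK : 0 ≤ M * ((n : ℝ) ^ (-(β / 2)) * (n : ℝ)⁻¹) := by positivity
    rw [hE, integral_finsetSum _ fun k _ => integrable_finsetSum _ fun l hl =>
      integrable_finsetSum _ fun b hb => hEterm k l hl b hb]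
    -- The sums over `l` and `b` are absorbed by the row norms; the sum over `k` uses up the factor
    -- `n⁻¹`.
    calc _ ≤ ∑ k : Fin n, M * ((n : ℝ) ^ (-(β / 2)) * (n : ℝ)⁻¹) := by
          refine Finset.sum_le_sum fun k _ => ?_
          rw [integral_finsetSum _ fun l hl => integrable_finsetSum _ fun b hb => hEterm k l hl b hb]
          calc _ ≤ ∑ l with k ≠ l, ∑ b with k ≠ b, A k l ^ 2 * A k b ^ 2 *
                (M * ((n : ℝ) ^ (-(β / 2)) * (n : ℝ)⁻¹)) := by
                refine Finset.sum_le_sum fun l hl => ?_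
                rw [integral_finsetSum _ fun b hb => hEterm k l hl b hb]
                refine Finset.sum_le_sum fun b hb => ?_
                rw [integral_const_mul]
                refine mul_le_mul_of_nonneg_left ?_ (by positivity)
                exact integral_tripleBound_le hβ4 hc h2 hβ (Finset.mem_filter.1 hl).2
                  (Finset.mem_filter.1 hb).2
            _ = (∑ l with k ≠ l, A k l ^ 2) * (∑ b with k ≠ b, A k b ^ 2) *
                (M * ((n : ℝ) ^ (-(β / 2)) * (n : ℝ)⁻¹)) := by
                rw [Finset.sum_mul_sum, Finset.sum_mul]
                simp only [Finset.sum_mul]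
            _ ≤ _ := by
                have hle : ∑ l with k ≠ l, A k l ^ 2 ≤ 1 :=
                  (Finset.sum_le_sum_of_subset_of_nonneg (Finset.subset_univ _)
                    fun _ _ _ => by positivity).trans (hA k)
                exact mul_le_of_le_one_left hK (mul_le_one₀ hle (by positivity) hle)
      _ = M * (n : ℝ) ^ (-(β / 2)) := by
          simp only [Finset.sum_const, Finset.card_univ, Fintype.card_fin, nsmul_eq_mul]
          field_simp
  calc ∫ z, offDiagForm A (selfNorm z) ^ 4 ∂(Measure.pi fun _ => ν)
      ≤ 108 * ∫ z, (bad.indicator 1 z + E z) ∂(Measure.pi fun _ => ν) :=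
        integral_offDiagForm_pow_four_le hsymm hA (hbi.add hEi) hWD
    _ ≤ 108 * ((n : ℝ) ^ (-(β / 2)) + M * (n : ℝ) ^ (-(β / 2))) := by
        rw [integral_add hbi hEi, integral_indicator_one hset]
        gcongr
        exact (hball n).trans hρβ
    _ = _ := by ring

/-! ### The residual projection. -/

/-- The projection `I - Bᵀ (B Bᵀ)⁻¹ B`. -/
noncomputable def residualProj {i n : ℕ} (B : Fin i → Fin n → ℝ) : Matrix (Fin n) (Fin n) ℝ :=
  1 - (Matrix.of B)ᵀ * (Matrix.of B * (Matrix.of B)ᵀ)⁻¹ * Matrix.of B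

lemma residualProj_transpose {i n : ℕ} (B : Fin i → Fin n → ℝ) :
    (residualProj B)ᵀ = residualProj B := by
  simp [residualProj, Matrix.transpose_nonsing_inv, Matrix.mul_assoc]

lemma residualProj_mul_self {i n : ℕ} (B : Fin i → Fin n → ℝ) :
    residualProj B * residualProj B = residualProj B := by
  set M := Matrix.of B
  set G := M * Mᵀ with hG
  have h : (Mᵀ * G⁻¹ * M) * (Mᵀ * G⁻¹ * M) = Mᵀ * G⁻¹ * M := by
    by_cases hdet : IsUnit G.det
    · calc (Mᵀ * G⁻¹ * M) * (Mᵀ * G⁻¹ * M) = Mᵀ * G⁻¹ * (G * G⁻¹) * M := by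
            simp only [hG, Matrix.mul_assoc]
        _ = _ := by rw [Matrix.mul_nonsing_inv _ hdet, Matrix.mul_one]
    -- In the singular case the inverse is `0`, and the projection is the identity.
    · simp [Matrix.nonsing_inv_apply_not_isUnit _ hdet]
  change (1 - Mᵀ * G⁻¹ * M) * (1 - Mᵀ * G⁻¹ * M) = 1 - Mᵀ * G⁻¹ * M
  rw [sub_mul, mul_sub, mul_sub, h]
  simp

/-- Symmetry and idempotence turn the row sum into the diagonal entry `d`; since `d²` is one of its
summands, `d² ≤ d` and thus `d ≤ 1`. -/
lemma sum_residualProj_sq_le_one {i n : ℕ} (B : Fin i → Fin n → ℝ) (k : Fin n) :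
    ∑ l, residualProj B k l ^ 2 ≤ 1 := by
  have h : ∑ l, residualProj B k l ^ 2 = residualProj B k k := by
    conv_rhs => rw [← residualProj_mul_self B]
    rw [Matrix.mul_apply]
    refine Finset.sum_congr rfl fun l _ => ?_
    rw [sq]
    congr 1
    conv_lhs => rw [← residualProj_transpose B]
    rfl
  have h1 : residualProj B k k ^ 2 ≤ ∑ l, residualProj B k l ^ 2 :=
    Finset.single_le_sum (f := fun l => residualProj B k l ^ 2) (fun _ _ => by positivity)
      (Finset.mem_univ k)
  rw [h] at h1 ⊢
  nlinarith

/-- The inverse is discontinuous at singular matrices, but it is the inverted determinant times the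
adjugate, hence measurable. -/
lemma measurable_residualProj_apply {i n : ℕ} (k l : Fin n) :
    Measurable fun B : Fin i → Fin n → ℝ => residualProj B k l := by
  have hG : Continuous fun B : Fin i → Fin n → ℝ => Matrix.of B * (Matrix.of B)ᵀ := by
    have : Continuous fun B : Fin i → Fin n → ℝ => Matrix.of B := continuous_id
    exact this.matrix_mul this.matrix_transpose
  have hinv (a b : Fin i) : Measurable fun B : Fin i → Fin n → ℝ =>
      (Matrix.of B * (Matrix.of B)ᵀ)⁻¹ a b := by
    simp only [Matrix.inv_def, Ring.inverse_eq_inv', Matrix.smul_apply, smul_eq_mul]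
    exact hG.matrix_det.measurable.inv.mul (hG.matrix_adjugate.matrix_elem a b).measurable
  have hB (a : Fin i) (k : Fin n) : Measurable fun B : Fin i → Fin n → ℝ => Matrix.of B a k :=
    (measurable_pi_apply k).comp (measurable_pi_apply a)
  simp only [residualProj, Matrix.sub_apply, Matrix.mul_apply, Matrix.transpose_apply]
  exact measurable_const.sub (Finset.measurable_sum _ fun b _ =>
    (Finset.measurable_sum _ fun a _ => (hB a k).mul (hinv a b)).mul (hB b l))

/-! ### Conditioning on the first rows. -/

lemma offDiag_eq {Ω : Type*} (X : ℕ → ℕ → Ω → ℝ) (n i : ℕ) (ω : Ω) :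
    offDiag X n i ω = ((n : ℝ) - i)⁻¹ *
      offDiagForm (residualProj fun (a : Fin i) (k : Fin n) => X a k ω)
        (selfNorm fun k : Fin n => X i k ω) := by
  simp only [offDiag, offDiagForm, Finset.mul_sum, Q, Matrix.smul_apply, smul_eq_mul, mul_assoc]
  rfl

/-- The first `i` rows and the next row are jointly distributed as a product measure. -/
lemma map_rows_prodMk_eq_prod {Ω : Type*} [MeasurableSpace Ω] {μ : Measure Ω}
    [IsProbabilityMeasure μ] {X : ℕ → ℕ → Ω → ℝ} (hmeas : ∀ i j, Measurable (X i j))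
    (hindep : iIndepFun (fun ij : ℕ × ℕ => X ij.1 ij.2) μ)
    (hident : ∀ i j, IdentDistrib (X i j) (X 0 0) μ μ) (n i : ℕ) :
    μ.map (fun ω => ((fun (a : Fin i) (k : Fin n) => X a k ω), fun k : Fin n => X i k ω)) =
      (μ.map fun ω (a : Fin i) (k : Fin n) => X a k ω).prod
        (Measure.pi fun _ => μ.map (X 0 0)) := by
  have hR : Measurable fun ω (a : Fin i) (k : Fin n) => X a k ω :=
    measurable_pi_iff.2 fun a => measurable_pi_iff.2 fun k => hmeas a k
  have hZ : Measurable fun ω (k : Fin n) => X i k ω := measurable_pi_iff.2 fun k => hmeas i k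
  set S := Finset.range i ×ˢ Finset.range n
  set T := ({i} : Finset ℕ) ×ˢ Finset.range n
  have hST : Disjoint S T := by
    rw [Finset.disjoint_left]
    rintro ⟨a, k⟩ h1 h2
    simp only [S, T, Finset.mem_product, Finset.mem_range, Finset.mem_singleton] at h1 h2
    omega
  have h1 := hindep.indepFun_finset S T hST fun ij => hmeas ij.1 ij.2
  have h2 : IndepFun (fun ω (a : Fin i) (k : Fin n) => X a k ω) (fun ω (k : Fin n) => X i k ω) μ :=
    h1.comp
      (φ := fun (f : S → ℝ) (a : Fin i) (k : Fin n) => f ⟨((a : ℕ), (k : ℕ)), by simp [S]⟩)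
      (ψ := fun (f : T → ℝ) (k : Fin n) => f ⟨(i, (k : ℕ)), by simp [T]⟩)
      (by fun_prop) (by fun_prop)
  rw [(indepFun_iff_map_prod_eq_prod_map_map hR.aemeasurable hZ.aemeasurable).1 h2]
  congr 1
  have h3 : iIndepFun (fun k : Fin n => X i k) μ :=
    hindep.precomp (g := fun k : Fin n => (i, (k : ℕ))) fun a b h => by
      simpa [Fin.ext_iff] using h
  rw [(iIndepFun_iff_map_fun_eq_pi_map fun k : Fin n => (hmeas i k).aemeasurable).1 h3]
  congr 1
  ext1 k
  exact (hident i k).map_eq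

lemma measurable_offDiagForm_residualProj {n i : ℕ} :
    Measurable fun q : (Fin i → Fin n → ℝ) × (Fin n → ℝ) =>
      offDiagForm (residualProj q.1) (selfNorm q.2) := by
  unfold offDiagForm
  refine Finset.measurable_sum _ fun k _ => Finset.measurable_sum _ fun l _ => ?_
  exact (((measurable_residualProj_apply k l).comp measurable_fst).mul
    ((measurable_selfNorm k).comp measurable_snd)).mul ((measurable_selfNorm l).comp measurable_snd)

/-- A bound for the conditional expectation given the first of two independent variables. -/
lemma integral_le_of_map_prodMk_eq_prod {Ω E E' : Type*} [MeasurableSpace Ω] [MeasurableSpace E]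
    [MeasurableSpace E'] {μ : Measure Ω} [IsProbabilityMeasure μ] {R : Ω → E} {Z : Ω → E'}
    (hR : Measurable R) (hZ : Measurable Z) {ν : Measure E'} [IsProbabilityMeasure ν]
    (hlaw : μ.map (fun ω => (R ω, Z ω)) = (μ.map R).prod ν) {F : E × E' → ℝ} (hF : Measurable F)
    {b K : ℝ} (hFb : ∀ q, ‖F q‖ ≤ b) (hK : ∀ x, ∫ z, F (x, z) ∂ν ≤ K) :
    ∫ ω, F (R ω, Z ω) ∂μ ≤ K := by
  have : IsProbabilityMeasure (μ.map R) := Measure.isProbabilityMeasure_map hR.aemeasurable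
  have hFi : Integrable F ((μ.map R).prod ν) :=
    Integrable.of_bound hF.aestronglyMeasurable _ (ae_of_all _ hFb)
  rw [← integral_map (hR.prodMk hZ).aemeasurable hF.aestronglyMeasurable, hlaw,
    integral_prod _ hFi]
  calc _ ≤ ∫ _, K ∂(μ.map R) := integral_mono hFi.integral_prod_left (integrable_const K) hK
    _ = K := by simp

/-- Because `K` is uniform over admissible matrices, it bounds the inner integral for every
realization of the first `i` rows, and Fubini finishes. -/
lemma integrable_offDiag_pow_and_integral_le {Ω : Type*} [MeasurableSpace Ω] {μ : Measure Ω}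
    [IsProbabilityMeasure μ] {X : ℕ → ℕ → Ω → ℝ} (hmeas : ∀ i j, Measurable (X i j))
    (hindep : iIndepFun (fun ij : ℕ × ℕ => X ij.1 ij.2) μ)
    (hident : ∀ i j, IdentDistrib (X i j) (X 0 0) μ μ) {n : ℕ} (i : ℕ) {K : ℝ}
    (hK : ∀ A : Matrix (Fin n) (Fin n) ℝ, (∀ k, ∑ l, A k l ^ 2 ≤ 1) →
        ∫ z, offDiagForm A (selfNorm z) ^ 4 ∂(Measure.pi fun _ => μ.map (X 0 0)) ≤ K) :
    Integrable (fun ω => offDiag X n i ω ^ 4) μ ∧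
      ∫ ω, offDiag X n i ω ^ 4 ∂μ ≤ (((n : ℝ) - i)⁻¹) ^ 4 * K := by
  have : IsProbabilityMeasure (μ.map (X 0 0)) :=
    Measure.isProbabilityMeasure_map (hmeas 0 0).aemeasurable
  have hR : Measurable fun ω (a : Fin i) (k : Fin n) => X a k ω :=
    measurable_pi_iff.2 fun a => measurable_pi_iff.2 fun k => hmeas a k
  have hZ : Measurable fun ω (k : Fin n) => X i k ω := measurable_pi_iff.2 fun k => hmeas i k
  have hFm : Measurable fun q : (Fin i → Fin n → ℝ) × (Fin n → ℝ) =>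
    offDiagForm (residualProj q.1) (selfNorm q.2) ^ 4 :=
      measurable_offDiagForm_residualProj.pow_const 4
  have hFb : ∀ q : (Fin i → Fin n → ℝ) × (Fin n → ℝ),
      ‖offDiagForm (residualProj q.1) (selfNorm q.2) ^ 4‖ ≤ (n * n : ℝ) ^ 4 := fun q => by
    rw [Real.norm_eq_abs, abs_pow]
    exact pow_le_pow_left₀ (abs_nonneg _)
      (abs_offDiagForm_selfNorm_le (sum_residualProj_sq_le_one q.1) q.2) 4
  have hint : ∫ ω, offDiagForm (residualProj fun (a : Fin i) (k : Fin n) => X a k ω)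
      (selfNorm fun k : Fin n => X i k ω) ^ 4 ∂μ ≤ K :=
    integral_le_of_map_prodMk_eq_prod (F := fun q => offDiagForm (residualProj q.1)
      (selfNorm q.2) ^ 4) hR hZ (map_rows_prodMk_eq_prod hmeas hindep hident n i) hFm hFb
      fun B => hK (residualProj B) (sum_residualProj_sq_le_one B)
  have hi : Integrable (fun ω => offDiagForm (residualProj fun (a : Fin i) (k : Fin n) => X a k ω)
      (selfNorm fun k : Fin n => X i k ω) ^ 4) μ :=
    Integrable.of_bound (hFm.comp (hR.prodMk hZ)).aestronglyMeasurable ((n * n : ℝ) ^ 4)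
      (ae_of_all _ fun ω => hFb (_, _))
  simp only [offDiag_eq, mul_pow]
  refine ⟨hi.const_mul _, ?_⟩
  rw [integral_const_mul]
  exact mul_le_mul_of_nonneg_left hint (by positivity)

lemma RegVaryingTail.map {Ω : Type*} [MeasurableSpace Ω] {μ : Measure Ω} {ξ : Ω → ℝ} {α : ℝ}
    (h : RegVaryingTail μ ξ α) (hξ : Measurable ξ) : RegVaryingTail (μ.map ξ) id α := by
  obtain ⟨L, hL, ht⟩ := h
  refine ⟨L, hL, fun x hx => ?_⟩
  rw [← ht x hx, map_measureReal_apply hξ]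
  · rfl
  · exact measurableSet_lt measurable_const (by fun_prop)

end HeavyCorr

/-! ### Choice of exponents and conclusion. -/

theorem propositionA1 {Ω : Type*} [MeasurableSpace Ω] (μ : Measure Ω) [IsProbabilityMeasure μ]
    (X : ℕ → ℕ → Ω → ℝ)
    (hmeas : ∀ i j, Measurable (X i j))
    (hindep : iIndepFun (fun ij : ℕ × ℕ => X ij.1 ij.2) μ)
    (hident : ∀ i j, IdentDistrib (X i j) (X 0 0) μ μ)
    (hsymm : IdentDistrib (X 0 0) (fun ω => -X 0 0 ω) μ μ)
    (α : ℝ) (hα2 : 2 < α) (hα4 : α < 4)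
    (htail : HeavyCorr.RegVaryingTail μ (X 0 0) α)
    (p : ℕ → ℕ) (γ : ℝ) (hγ0 : 0 < γ) (hγ1 : γ < 1)
    (hp : Tendsto p atTop atTop)
    (hpn : Tendsto (fun n : ℕ => (p n : ℝ) / (n : ℝ)) atTop (𝓝 γ))
    (ε : ℝ) (hε : 0 < ε) :
    ∃ C : ℝ, 0 < C ∧ ∀ᶠ n : ℕ in atTop, ∀ i : ℕ, i < p n →
      Integrable (fun ω => HeavyCorr.offDiag X n i ω ^ 4) μ ∧
      (n : ℝ) ^ 4 * ∫ ω, HeavyCorr.offDiag X n i ω ^ 4 ∂μ ≤ C * (n : ℝ) ^ (-α / 2 + ε) := by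
  have hX := hmeas 0 0
  have : IsProbabilityMeasure (μ.map (X 0 0)) := Measure.isProbabilityMeasure_map hX.aemeasurable
  have htail' := htail.map hX
  have hsymm' : (μ.map (X 0 0)).map (fun x => -x) = μ.map (X 0 0) := by
    rw [Measure.map_map measurable_neg hX]
    exact hsymm.map_eq.symm
  -- The maximum with `2` keeps `β` positive when `ε` is large, while still `β < α` and `-β/2 ≤ -α/2
  -- + ε`.
  set β := max (α - 2 * ε) 2 with hβ
  have hβ2 : 2 ≤ β := le_max_right _ _
  have hβα : β < α := max_lt (by linarith) hα2
  have hβε : α - 2 * ε ≤ β := le_max_left _ _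
  have hint2 : Integrable (fun x : ℝ => x ^ 2) (μ.map (X 0 0)) := by
    simpa using htail'.integrable_rpow_abs two_pos hα2
  obtain ⟨C, hC, hbound⟩ := HeavyCorr.exists_integral_offDiagForm_pow_four_le hsymm'
    htail'.measure_ne_zero (by linarith) (by linarith) hint2
    (htail'.integrable_rpow_abs (by linarith) hβα)
  -- Since `γ < 1 - κ`, eventually `p n < (1 - κ) n`, so `n - i ≥ κ n` for all `i < p n`.
  set κ := (1 - γ) / 2 with hκ
  have hκ0 : 0 < κ := by rw [hκ]; linarith
  refine ⟨(κ⁻¹) ^ 4 * C, by positivity, ?_⟩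
  filter_upwards [hbound, eventually_ge_atTop 1,
    hpn.eventually (gt_mem_nhds (show γ < 1 - κ by rw [hκ]; linarith))] with n hn hn1 hpn i hi
  have hn1' : 1 ≤ (n : ℝ) := by exact_mod_cast hn1
  have hn0 : 0 < (n : ℝ) := by positivity
  obtain ⟨h1, h2⟩ := HeavyCorr.integrable_offDiag_pow_and_integral_le hmeas hindep hident i hn
  refine ⟨h1, ?_⟩
  have hi' : (i : ℝ) < p n := by exact_mod_cast hi
  have hni : κ * n ≤ n - i := by
    rw [div_lt_iff₀ hn0] at hpn
    linarith
  have hexp : (n : ℝ) ^ (-(β / 2)) ≤ (n : ℝ) ^ (-α / 2 + ε) :=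
    Real.rpow_le_rpow_of_exponent_le hn1' (by linarith)
  calc (n : ℝ) ^ 4 * ∫ ω, HeavyCorr.offDiag X n i ω ^ 4 ∂μ
      ≤ (n : ℝ) ^ 4 * ((((n : ℝ) - i)⁻¹) ^ 4 * (C * (n : ℝ) ^ (-(β / 2)))) := by gcongr
    _ ≤ (n : ℝ) ^ 4 * (((κ * n)⁻¹) ^ 4 * (C * (n : ℝ) ^ (-α / 2 + ε))) := by
        have hκn : 0 < κ * n := by positivity
        have : 0 < (n : ℝ) - i := hκn.trans_le hni
        gcongr
    _ = (κ⁻¹) ^ 4 * C * (n : ℝ) ^ (-α / 2 + ε) := by field_simp
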